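/- **Corollary (Posterior consistency).** Let $\mathfrak X$ be a countable set equipped with the $\sigma$-algebra of all its subsets. For finite measures $Q,Q'$ on $\mathfrak X$ put $\|Q-Q'\|_{\mathrm{Tot.Var.}}:=\sup_{C\subset\mathfrak X}|Q(C)-Q'(C)|$. For a probability measure $\mu$ on $\mathfrak X$ and $m>0$, let $DP(\mu,m)$ denote the Dirichlet process with mean $\mu$ and concentration parameter $m$, i.e. the law of a random probability measure $D$ on $\mathfrak X$ such that, for every finite partition $(A_1,\dots,A_k)$ of $\mathfrak X$, the vector $(D(A_1),\dots,D(A_k))$ has the Dirichlet distribution with parameters $(m\mu(A_1),\dots,m\mu(A_k))$ (coordinates with parameter $0$ being equal to $0$). Sethuraman's representation of it is $D=\sum_{i\ge 0}\beta_i\delta_{Y_i}$, where $\beta_i=V_i\prod_{j<i}(1-V_j)$, the $V_i$ are i.i.d. with law $\mathrm{Beta}(1,m)$, the $Y_i$ are i.i.d. with law $\mu$, and the sequences $(V_i)$ and $(Y_i)$ are independent. Let $\alpha$ and $\mathbf P_0$ be probability measures on $\mathfrak X$ and let $M>0$. For a sequence $(x_i)_{i\ge1}$ in $\mathfrak X$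 and $n\ge 1$ put $$\mathbf P_{(x_1,\dots,x_n)}:=\frac1n\sum_{i=1}^n\delta_{x_i},\qquad \theta_n:=\frac{M}{M+n},\qquad \alpha_{(x_1,\dots,x_n)}:=\theta_n\,\alpha+(1-\theta_n)\,\mathbf P_{(x_1,\dots,x_n)},$$ and let $Post_n(x_1,\dots,x_n)$ be a random probability measure with law $DP(\alpha_{(x_1,\dots,x_n)},M+n)$ (the posterior, given the observations $x_1,\dots,x_n$, for the prior $DP(\alpha,M)$). Then for $\mathbf P_0^{\otimes\mathbb N^*}$-almost every sequence $(x_i)_{i\ge1}$, $$\big\|Post_n(x_1,\dots,x_n)-\mathbf P_{(x_1,\dots,x_n)}\big\|_{\mathrm{Tot.Var.}}\longrightarrow 0\quad\text{in law as } n\to\infty,$$ both for every choice of random probability measures $Post_n(x_1,\dots,x_n)$ with the defining finite-dimensional Dirichlet distributions and for those given by Sethuraman's representation. -/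

import Mathlib

open MeasureTheory ProbabilityTheory Filter
open scoped ENNReal

noncomputable section

namespace DirichletPosterior

variable {X : Type*} [MeasurableSpace X]

/-- Total variation distance `sup_C |Q(C) - Q'(C)|`. It is used on countable spaces in which all
subsets are measurable, so the supremum runs over all subsets. -/
def tvDist (Q Q' : Measure X) : ℝ := ⨆ C : Set X, |Q.real C - Q'.real C|

/-- Empirical measure `n⁻¹ ∑_{i<n} δ_{x i}` of the first `n` observations (zero for `n = 0`). -/
def empirical (x : ℕ → X) (n : ℕ) : Measure X :=
  (n : ℝ≥0∞)⁻¹ • ∑ i ∈ Finset.range n, Measure.dirac (x i)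

/-- `θ_n = M / (M + n)`. -/
def theta (M : ℝ) (n : ℕ) : ℝ := M / (M + n)

/-- Mean of the posterior after `n` observations: `θ_n α + (1 - θ_n) n⁻¹ ∑_{i<n} δ_{x i}`. -/
def posteriorMean (α : Measure X) (M : ℝ) (x : ℕ → X) (n : ℕ) : Measure X :=
  ENNReal.ofReal (theta M n) • α + ENNReal.ofReal (1 - theta M n) • empirical x n

/-- Gamma distribution with shape `a ≥ 0` and rate `1`; it is the point mass at `0` for `a = 0`. -/
def gammaLaw (a : ℝ) : Measure ℝ := if a = 0 then Measure.dirac 0 else gammaMeasure a 1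

/-- Dirichlet distribution with parameters `a i ≥ 0`, not all zero: the law of
`(G_i / ∑ j, G_j)_i` for independent `G_i` with gamma distribution of shape `a i`. -/
def dirichletDist {k : ℕ} (a : Fin k → ℝ) : Measure (Fin k → ℝ) :=
  (Measure.pi fun i => gammaLaw (a i)).map fun g i => g i / ∑ j, g j

/-- `D`, a law on the space of measures on `X`, is the law `DP(α, M)` of a Dirichlet process with
mean `α` and concentration `M`: it is carried by the probability measures, and for each finite
measurable partition `A_1, …, A_k` of `X` the vector `(Q(A_1), …, Q(A_k))`, with `Q` drawn from
`D`, is Dirichlet distributed with parameters `M α(A_1), …, M α(A_k)`. -/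
structure IsDirichletProcess (α : Measure X) (M : ℝ) (D : Measure (Measure X)) : Prop where
  ae_isProbabilityMeasure : ∀ᵐ Q ∂D, IsProbabilityMeasure Q
  map_partition : ∀ (k : ℕ) (A : Fin k → Set X), (∀ i, MeasurableSet (A i)) →
    Pairwise (fun i j => Disjoint (A i) (A j)) → (⋃ i, A i) = Set.univ →
      D.map (fun Q i => Q.real (A i)) = dirichletDist fun i => M * α.real (A i)

/-- Stick-breaking weights `v_i ∏_{j<i} (1 - v_j)`. -/
def stickWeight (v : ℕ → ℝ) (i : ℕ) : ℝ := v i * ∏ j ∈ Finset.range i, (1 - v j)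

/-- The discrete measure `∑_i β_i δ_{y_i}` with stick-breaking weights `β`. -/
def stickMeasure (p : (ℕ → ℝ) × (ℕ → X)) : Measure X :=
  Measure.sum fun i => ENNReal.ofReal (stickWeight p.1 i) • Measure.dirac (p.2 i)

/-- Law of `∑_i β_i δ_{Y_i}`, where `β` are the stick-breaking weights of an i.i.d. sequence
`V_i ∼ Beta(1, M)`, independent of the i.i.d. sequence `Y_i ∼ α`. -/
def stickBreakingLaw (α : Measure X) (M : ℝ) : Measure (Measure X) :=
  ((Measure.infinitePi fun _ : ℕ => betaMeasure 1 M).prod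
    (Measure.infinitePi fun _ : ℕ => α)).map stickMeasure

theorem measurable_stickMeasure : Measurable (stickMeasure (X := X)) := by
  refine Measure.measurable_of_measurable_coe _ fun s hs => ?_
  simp only [stickMeasure, Measure.sum_apply _ hs, Measure.smul_apply, smul_eq_mul,
    Measure.dirac_apply' _ hs]
  refine Measurable.tsum fun i => ?_
  refine Measurable.mul ?_ ?_
  · unfold stickWeight
    fun_prop
  · exact (measurable_one.indicator hs).comp (by fun_prop)

theorem isProbabilityMeasure_stickBreakingLaw (α : Measure X) [IsProbabilityMeasure α] {M : ℝ}
    (hM : 0 < M) : IsProbabilityMeasure (stickBreakingLaw α M) := by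
  have := isProbabilityMeasureBeta one_pos hM
  exact Measure.isProbabilityMeasure_map measurable_stickMeasure.aemeasurable

theorem isProbabilityMeasure_posteriorMean (α : Measure X) [IsProbabilityMeasure α] {M : ℝ}
    (hM : 0 < M) (x : ℕ → X) (n : ℕ) : IsProbabilityMeasure (posteriorMean α M x n) := by
  have hn : (0 : ℝ) ≤ n := n.cast_nonneg
  have h0 : 0 ≤ theta M n := by unfold theta; positivity
  have h1 : theta M n ≤ 1 := by
    unfold theta
    rw [div_le_one (by positivity)]
    linarith
  refine ⟨?_⟩
  rcases Nat.eq_zero_or_pos n with rfl | hpos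
  · simp [posteriorMean, theta, hM.ne']
  · have he : empirical x n Set.univ = 1 := by
      simp [empirical, ENNReal.inv_mul_cancel, hpos.ne']
    simp only [posteriorMean, Measure.add_apply, Measure.smul_apply, he, measure_univ,
      smul_eq_mul, mul_one]
    rw [← ENNReal.ofReal_add h0 (by linarith)]
    simp

/-- The stick-breaking version of the posterior law `DP(α_{x_1,…,x_n}, M + n)`. -/
def stickBreakingPosterior (α : ProbabilityMeasure X) (M : ℝ) (hM : 0 < M) (x : ℕ → X) (n : ℕ) :
    ProbabilityMeasure (Measure X) :=
  ⟨stickBreakingLaw (posteriorMean (α : Measure X) M x n) (M + n),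
    have := isProbabilityMeasure_posteriorMean (α : Measure X) hM x n
    isProbabilityMeasure_stickBreakingLaw _ (by positivity)⟩

/-- For `Q_n` drawn from `Post n`, the total variation distance between `Q_n` and the empirical
measure of the first `n` observations converges in distribution to `0`. -/
def TVTendstoZeroInLaw (x : ℕ → X) (Post : ℕ → ProbabilityMeasure (Measure X)) : Prop :=
  TendstoInDistribution (fun n (Q : Measure X) => tvDist Q (empirical x n)) atTop
    (fun _ : Unit => (0 : ℝ)) (fun n => (Post n : Measure (Measure X))) (Measure.dirac ())

end DirichletPosterior

end

namespace DirichletPosterior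

open scoped Topology

/-! Everything rests on one concentration bound: if `Q` is drawn from a Dirichlet process with mean
`m` and concentration `s`, then `E|Q(A) - m(A)| ≤ 3 / √s`, uniformly in `m` and `A`. It is proved
separately for each description of the process: from the gamma representation of Dirichlet vectors
(`IsDirichletProcess.integral_abs_sub_le`) and from the second moments of the stick-breaking weights
(`integral_abs_stickBreakingLaw_sub_le`). The rest uses only this bound on singletons and the fact
that `Q` is almost surely a probability measure, so the two laws need not be identified with each
other.

For the posterior, `s = M + n` tends to infinity and `m` is within `θ_n → 0` of the empirical
measure. Singletons control total variation up to a tail: for finite `F`, the distance from `Q` to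
`m` is at most `2 ∑_{y ∈ F} |Q{y} - m{y}| + 2 m(Fᶜ)` (`abs_measureReal_sub_le`). By the strong law,
almost surely the empirical mass of `Fᶜ` tends to `P₀(Fᶜ)` for all of the countably many finite `F`
at once. Hence the limsup of the expected distance is at most `2 P₀(Fᶜ)`, which is arbitrarily
small, and convergence of the means of nonnegative variables to `0` implies convergence in law. -/

theorem integrable_and_integral_eq_of_lintegral_ofReal {Ω : Type*} [MeasurableSpace Ω]
    {μ : Measure Ω} {f : Ω → ℝ} {c : ℝ} (hf : Measurable f) (h0 : 0 ≤ᵐ[μ] f) (hc : 0 ≤ c)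
    (h : ∫⁻ x, ENNReal.ofReal (f x) ∂μ = ENNReal.ofReal c) :
    Integrable f μ ∧ ∫ x, f x ∂μ = c := by
  constructor
  · refine ⟨hf.aestronglyMeasurable, ?_⟩
    rw [hasFiniteIntegral_iff_ofReal h0, h]
    exact ENNReal.ofReal_lt_top
  · rw [integral_eq_lintegral_of_nonneg_ae h0 hf.aestronglyMeasurable, h,
      ENNReal.toReal_ofReal hc]

/-- Jensen inequality for the square. -/
theorem integral_abs_le_sqrt_integral_sq {Ω : Type*} [MeasurableSpace Ω] {μ : Measure Ω}
    [IsProbabilityMeasure μ] {f : Ω → ℝ} (hf : MemLp f 2 μ) :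
    ∫ x, |f x| ∂μ ≤ √(∫ x, f x ^ 2 ∂μ) := by
  have h1 : MemLp (fun x => |f x|) 2 μ := hf.abs
  have h2 := variance_nonneg (fun x => |f x|) μ
  rw [variance_eq_sub h1] at h2
  refine Real.le_sqrt_of_sq_le ?_
  simp only [Pi.pow_apply, sq_abs] at h2
  linarith

/-! ### Moments of the gamma distribution -/

/-- Size biasing: since `Γ(a + 1) = a Γ(a)`, multiplying the density of shape `a` by `x` gives `a`
times the density of shape `a + 1`. Iteration yields the moments, and working in `ℝ≥0∞` yields
integrability along with them. -/
theorem lintegral_ofReal_mul_gammaMeasure {a : ℝ} (ha : 0 < a) {g : ℝ → ℝ≥0∞}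
    (hg : Measurable g) :
    ∫⁻ x, ENNReal.ofReal x * g x ∂(gammaMeasure a 1) =
      ENNReal.ofReal a * ∫⁻ x, g x ∂(gammaMeasure (a + 1) 1) := by
  have hm : ∀ b : ℝ, Measurable (gammaPDF b 1) := fun b =>
    (measurable_gammaPDFReal b 1).ennreal_ofReal
  rw [gammaMeasure, gammaMeasure, lintegral_withDensity_eq_lintegral_mul _ (hm a) (by fun_prop),
    lintegral_withDensity_eq_lintegral_mul _ (hm _) hg,
    ← lintegral_const_mul _ (by exact (hm _).mul hg)]
  refine lintegral_congr_ae ?_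
  -- The origin is discarded because `Real.rpow_add_one` needs a nonzero base.
  filter_upwards [(Measure.ae_ne volume (0 : ℝ))] with x hx
  rcases lt_or_gt_of_ne hx with hx | hx
  · simp [gammaPDF_of_neg hx]
  · simp only [Pi.mul_apply]
    rw [← mul_assoc, ← mul_assoc, gammaPDF, gammaPDF,
      ← ENNReal.ofReal_mul (gammaPDFReal_nonneg ha one_pos x), ← ENNReal.ofReal_mul ha.le]
    congr 2
    simp only [gammaPDFReal, if_pos hx.le, Real.one_rpow, Real.Gamma_add_one ha.ne']
    rw [show a + 1 - 1 = (a - 1) + 1 by ring, Real.rpow_add_one hx.ne']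
    have := (Real.Gamma_pos_of_pos ha).ne'
    field_simp

theorem ae_nonneg_gammaMeasure (a : ℝ) : ∀ᵐ x ∂(gammaMeasure a 1), 0 ≤ x := by
  rw [gammaMeasure, ae_withDensity_iff
    (show Measurable (gammaPDF a 1) from (measurable_gammaPDFReal a 1).ennreal_ofReal)]
  refine ae_of_all _ fun x hx => ?_
  by_contra h
  exact hx (gammaPDF_of_neg (not_le.1 h))

theorem gammaMeasure_moment_one {a : ℝ} (ha : 0 < a) :
    Integrable (fun x : ℝ => x) (gammaMeasure a 1) ∧ ∫ x, x ∂(gammaMeasure a 1) = a := by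
  have := isProbabilityMeasure_gammaMeasure (a := a + 1) (r := 1) (by positivity) one_pos
  refine integrable_and_integral_eq_of_lintegral_ofReal measurable_id
    (ae_nonneg_gammaMeasure a) ha.le ?_
  simpa using lintegral_ofReal_mul_gammaMeasure ha (g := fun _ => 1) measurable_const

theorem gammaMeasure_moment_two {a : ℝ} (ha : 0 < a) :
    Integrable (fun x : ℝ => x ^ 2) (gammaMeasure a 1) ∧
      ∫ x, x ^ 2 ∂(gammaMeasure a 1) = a * (a + 1) := by
  have := isProbabilityMeasure_gammaMeasure (a := a + 1 + 1) (r := 1) (by positivity) one_pos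
  refine integrable_and_integral_eq_of_lintegral_ofReal (by fun_prop)
    (ae_of_all _ fun x => sq_nonneg x) (by positivity) ?_
  have h1 := lintegral_ofReal_mul_gammaMeasure ha (g := ENNReal.ofReal) ENNReal.measurable_ofReal
  have h2 := lintegral_ofReal_mul_gammaMeasure (a := a + 1) (by positivity) (g := fun _ => 1)
    measurable_const
  simp only [mul_one, lintegral_one, measure_univ] at h2
  rw [ENNReal.ofReal_mul ha.le, ← h2, ← h1]
  refine lintegral_congr_ae ?_
  filter_upwards [ae_nonneg_gammaMeasure a] with x hx
  rw [sq, ENNReal.ofReal_mul hx]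

theorem isProbabilityMeasure_gammaLaw {a : ℝ} (ha : 0 ≤ a) :
    IsProbabilityMeasure (gammaLaw a) := by
  unfold gammaLaw
  split_ifs with h
  · infer_instance
  · exact isProbabilityMeasure_gammaMeasure (lt_of_le_of_ne ha (Ne.symm h)) one_pos

theorem ae_nonneg_gammaLaw (a : ℝ) : ∀ᵐ x ∂(gammaLaw a), 0 ≤ x := by
  unfold gammaLaw
  split_ifs with h
  · rw [ae_dirac_iff measurableSet_Ici]
  · exact ae_nonneg_gammaMeasure a

theorem integrable_gammaLaw {a : ℝ} (ha : 0 ≤ a) : Integrable (fun x : ℝ => x) (gammaLaw a) := by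
  unfold gammaLaw
  split_ifs with h
  · exact integrable_dirac (by simp)
  · exact (gammaMeasure_moment_one (lt_of_le_of_ne ha (Ne.symm h))).1

/-- Mean and variance are both `a`, so the mean absolute deviation is at most the standard deviation
`√a`. -/
theorem integral_abs_sub_gammaLaw_le {a : ℝ} (ha : 0 ≤ a) :
    ∫ x, |x - a| ∂(gammaLaw a) ≤ √a := by
  unfold gammaLaw
  split_ifs with h
  · simp [h]
  · have ha' := lt_of_le_of_ne ha (Ne.symm h)
    have := isProbabilityMeasure_gammaMeasure ha' one_pos
    obtain ⟨i1, e1⟩ := gammaMeasure_moment_one ha'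
    obtain ⟨i2, e2⟩ := gammaMeasure_moment_two ha'
    have hL : MemLp (fun x : ℝ => x) 2 (gammaMeasure a 1) :=
      (memLp_two_iff_integrable_sq measurable_id.aestronglyMeasurable).2 i2
    refine (integral_abs_le_sqrt_integral_sq (f := fun x => x - a)
      (hL.sub (memLp_const a))).trans_eq ?_
    congr 1
    have : ∀ x : ℝ, (x - a) ^ 2 = x ^ 2 - 2 * a * x + a ^ 2 := fun x => by ring
    simp_rw [this]
    have i3 : Integrable (fun x : ℝ => x ^ 2 - 2 * a * x) (gammaMeasure a 1) :=
      i2.sub (i1.const_mul _)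
    rw [integral_add i3 (integrable_const _), integral_sub i2 (i1.const_mul _),
      integral_const_mul, e1, e2]
    simp
    ring

/-! ### Moments of the beta distribution `Beta(1, s)` -/

theorem ae_mem_Ioo_betaMeasure (a b : ℝ) : ∀ᵐ x ∂(betaMeasure a b), x ∈ Set.Ioo (0 : ℝ) 1 := by
  rw [betaMeasure, ae_withDensity_iff
    (show Measurable (betaPDF a b) from (measurable_betaPDFReal a b).ennreal_ofReal)]
  refine ae_of_all _ fun x hx => ⟨?_, ?_⟩
  · by_contra h
    exact hx (betaPDF_eq_zero_of_nonpos (not_lt.1 h))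
  · by_contra h
    exact hx (betaPDF_eq_zero_of_one_le (not_lt.1 h))

theorem beta_one_left {s : ℝ} (hs : 0 < s) : beta 1 s = s⁻¹ := by
  have := (Real.Gamma_pos_of_pos hs).ne'
  rw [beta, Real.Gamma_one, add_comm 1 s, Real.Gamma_add_one hs.ne']
  field_simp

/-- The analogue of size biasing: a factor `1 - x` raises the second parameter from `s` to `s + 1`,
and `s / (s + 1)` is the ratio of the normalizing constants. -/
theorem lintegral_ofReal_one_sub_mul_betaMeasure {s : ℝ} (hs : 0 < s) {g : ℝ → ℝ≥0∞}
    (hg : Measurable g) :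
    ∫⁻ x, ENNReal.ofReal (1 - x) * g x ∂(betaMeasure 1 s) =
      ENNReal.ofReal (s / (s + 1)) * ∫⁻ x, g x ∂(betaMeasure 1 (s + 1)) := by
  have hm : ∀ b : ℝ, Measurable (betaPDF 1 b) := fun b =>
    (measurable_betaPDFReal 1 b).ennreal_ofReal
  rw [betaMeasure, betaMeasure, lintegral_withDensity_eq_lintegral_mul _ (hm s) (by fun_prop),
    lintegral_withDensity_eq_lintegral_mul _ (hm _) hg,
    ← lintegral_const_mul _ (by exact (hm _).mul hg)]
  refine lintegral_congr fun x => ?_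
  by_cases hx : 0 < x ∧ x < 1
  · have hx1 : 0 < 1 - x := by linarith [hx.2]
    simp only [Pi.mul_apply]
    rw [← mul_assoc, ← mul_assoc, betaPDF, betaPDF,
      ← ENNReal.ofReal_mul (betaPDFReal_pos hx.1 hx.2 one_pos hs).le,
      ← ENNReal.ofReal_mul (by positivity)]
    congr 2
    simp only [betaPDFReal, if_pos hx, beta_one_left hs, beta_one_left (s := s + 1) (by positivity)]
    rw [show s + 1 - 1 = (s - 1) + 1 by ring, Real.rpow_add_one hx1.ne']
    field_simp
  · simp [betaPDF, betaPDFReal, hx]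

theorem betaMeasure_moment_one {s : ℝ} (hs : 0 < s) :
    ∫ x, (1 - x) ∂(betaMeasure 1 s) = s / (s + 1) := by
  have := isProbabilityMeasureBeta (α := 1) (β := s + 1) one_pos (by positivity)
  refine (integrable_and_integral_eq_of_lintegral_ofReal (by fun_prop)
    ?_ (by positivity) ?_).2
  · filter_upwards [ae_mem_Ioo_betaMeasure 1 s] with x hx
    exact sub_nonneg.2 hx.2.le
  simpa using lintegral_ofReal_one_sub_mul_betaMeasure hs (g := fun _ => 1) measurable_const

theorem betaMeasure_moment_two {s : ℝ} (hs : 0 < s) :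
    ∫ x, (1 - x) ^ 2 ∂(betaMeasure 1 s) = s / (s + 2) := by
  have := isProbabilityMeasureBeta (α := 1) (β := s + 1 + 1) one_pos (by positivity)
  refine (integrable_and_integral_eq_of_lintegral_ofReal (by fun_prop)
    (ae_of_all _ fun x => sq_nonneg _) (by positivity) ?_).2
  have h1 := lintegral_ofReal_one_sub_mul_betaMeasure hs (g := fun x => ENNReal.ofReal (1 - x))
    (by fun_prop)
  have h2 := lintegral_ofReal_one_sub_mul_betaMeasure (s := s + 1) (by positivity)
    (g := fun _ => 1) measurable_const
  simp only [mul_one, lintegral_one, measure_univ] at h2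
  rw [h2, ← ENNReal.ofReal_mul (by positivity)] at h1
  rw [show s / (s + 2) = s / (s + 1) * ((s + 1) / (s + 1 + 1)) by field_simp; ring, ← h1]
  refine lintegral_congr_ae ?_
  filter_upwards [ae_mem_Ioo_betaMeasure 1 s] with x hx
  rw [sq, ENNReal.ofReal_mul (sub_nonneg.2 hx.2.le)]

/-- The value is left in this unsimplified form so that the second moments of the stick-breaking
weights telescope. -/
theorem betaMeasure_second_moment {s : ℝ} (hs : 0 < s) :
    ∫ x, x ^ 2 ∂(betaMeasure 1 s) = (1 - s / (s + 2)) / (s + 1) := by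
  have := isProbabilityMeasureBeta (α := 1) (β := s) one_pos hs
  have hb : ∀ f : ℝ → ℝ, Measurable f → (∀ x ∈ Set.Ioo (0 : ℝ) 1, |f x| ≤ 1) →
      Integrable f (betaMeasure 1 s) := fun f hf h => by
    refine Integrable.of_bound hf.aestronglyMeasurable 1 ?_
    filter_upwards [ae_mem_Ioo_betaMeasure 1 s] with x hx using h x hx
  have i1 : Integrable (fun x : ℝ => 1 - x) (betaMeasure 1 s) := hb _ (by fun_prop)
    fun x hx => abs_le.2 ⟨by linarith [hx.2], by linarith [hx.1]⟩
  have i2 : Integrable (fun x : ℝ => (1 - x) ^ 2) (betaMeasure 1 s) := hb _ (by fun_prop)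
    fun x hx => by
      rw [abs_of_nonneg (sq_nonneg _)]
      exact pow_le_one₀ (by linarith [hx.2]) (by linarith [hx.1])
  have : ∀ x : ℝ, x ^ 2 = 1 - 2 * (1 - x) + (1 - x) ^ 2 := fun x => by ring
  have i3 : Integrable (fun x : ℝ => 1 - 2 * (1 - x)) (betaMeasure 1 s) :=
    (integrable_const _).sub (i1.const_mul _)
  rw [integral_congr_ae (ae_of_all _ this), integral_add i3 i2,
    integral_sub (integrable_const _) (i1.const_mul _), integral_const_mul,
    betaMeasure_moment_one hs, betaMeasure_moment_two hs]
  simp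
  field_simp
  ring

/-! ### Concentration of the Dirichlet distribution and of the Dirichlet process -/

/-- With `S = ∑ g_j`, the difference equals `((g_i - a_i) - (g_i / S)(S - s)) / s`, and `g_i / S`
lies in `[0, 1]`. The random normalization is thus replaced by the constant `s` without any lower
bound on `S`. -/
theorem abs_div_sum_sub_div_le {ι : Type*} [Fintype ι] {g a : ι → ℝ} (hg : ∀ i, 0 ≤ g i)
    {s : ℝ} (hs : 0 < s) (ha : ∑ i, a i = s) (i : ι) :
    |g i / ∑ j, g j - a i / s| ≤ (|g i - a i| + ∑ j, |g j - a j|) / s := by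
  have hS : |∑ j, g j - s| ≤ ∑ j, |g j - a j| := by
    rw [← ha, ← Finset.sum_sub_distrib]
    exact Finset.abs_sum_le_sum_abs _ _
  have hle : g i ≤ ∑ j, g j := Finset.single_le_sum (fun j _ => hg j) (Finset.mem_univ i)
  generalize ∑ j, g j = S at hS hle
  have hr : |g i / S| ≤ 1 := by
    rw [abs_of_nonneg (div_nonneg (hg i) ((hg i).trans hle))]
    exact div_le_one_of_le₀ hle ((hg i).trans hle)
  have key : g i / S - a i / s = ((g i - a i) - g i / S * (S - s)) / s := by
    -- If `S = 0` then `g i = 0`, and the identity survives under the convention `x / 0 = 0`.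
    rcases eq_or_ne S 0 with rfl | h
    · have : g i = 0 := le_antisymm hle (hg i)
      simp [this, neg_div]
    · field_simp
      ring
  rw [key, abs_div, abs_of_pos hs]
  gcongr
  refine (abs_sub _ _).trans (add_le_add le_rfl ?_)
  rw [abs_mul]
  exact (mul_le_of_le_one_left (abs_nonneg _) hr).trans hS

/-- Each of the `k + 1` gamma deviations has mean at most `√(a j) ≤ √s`, and their sum is divided by
`s`. The dependence on `k` is harmless, since only `k = 2` is needed. -/
theorem integral_abs_dirichletDist_sub_le {k : ℕ} {a : Fin k → ℝ} (ha : ∀ i, 0 ≤ a i) {s : ℝ}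
    (hs : 0 < s) (hsum : ∑ i, a i = s) (i : Fin k) :
    ∫ v, |v i - a i / s| ∂(dirichletDist a) ≤ (k + 1) / √s := by
  have hp : ∀ i, IsProbabilityMeasure (gammaLaw (a i)) :=
    fun i => isProbabilityMeasure_gammaLaw (ha i)
  have hmap : Measurable fun (g : Fin k → ℝ) (i : Fin k) => g i / ∑ j, g j := by fun_prop
  have hint : ∀ j, Integrable (fun g : Fin k → ℝ => |g j - a j|)
      (Measure.pi fun i => gammaLaw (a i)) := fun j =>
    integrable_comp_eval (μ := fun i => gammaLaw (a i)) (f := fun x : ℝ => |x - a j|)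
      ((integrable_gammaLaw (ha j)).sub (integrable_const _)).abs
  have hval : ∀ j, ∫ g : Fin k → ℝ, |g j - a j| ∂(Measure.pi fun i => gammaLaw (a i)) ≤ √s := by
    intro j
    rw [integral_comp_eval (μ := fun i => gammaLaw (a i)) (f := fun x => |x - a j|)
      (by fun_prop)]
    refine (integral_abs_sub_gammaLaw_le (ha j)).trans (Real.sqrt_le_sqrt ?_)
    rw [← hsum]
    exact Finset.single_le_sum (fun j _ => ha j) (Finset.mem_univ j)
  have hae : ∀ᵐ g ∂(Measure.pi fun i => gammaLaw (a i)), ∀ j, 0 ≤ g j := by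
    rw [ae_all_iff]
    intro j
    exact (Measure.quasiMeasurePreserving_eval _ j).ae (ae_nonneg_gammaLaw (a j))
  have hsumint : Integrable (fun g : Fin k → ℝ => ∑ j, |g j - a j|)
      (Measure.pi fun i => gammaLaw (a i)) := integrable_finsetSum _ fun j _ => hint j
  rw [dirichletDist, integral_map hmap.aemeasurable
    (Continuous.aestronglyMeasurable (by fun_prop))]
  calc ∫ g : Fin k → ℝ, |g i / ∑ j, g j - a i / s| ∂(Measure.pi fun i => gammaLaw (a i))
      ≤ ∫ g : Fin k → ℝ, (|g i - a i| + ∑ j, |g j - a j|) / s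
          ∂(Measure.pi fun i => gammaLaw (a i)) := by
        refine integral_mono_of_nonneg (ae_of_all _ fun _ => abs_nonneg _)
          (((hint i).add hsumint).div_const s) ?_
        filter_upwards [hae] with g hg using abs_div_sum_sub_div_le hg hs hsum i
    _ ≤ (√s + ∑ _j : Fin k, √s) / s := by
        rw [integral_div, integral_add (hint i) hsumint, integral_finsetSum _ fun j _ => hint j]
        gcongr
        · exact hval i
        · exact hval _
    _ = (k + 1) / √s := by
        have h := Real.sqrt_pos.2 hs
        have h2 := Real.mul_self_sqrt hs.le
        simp only [Finset.sum_const, Finset.card_univ, Fintype.card_fin, nsmul_eq_mul]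
        rw [div_eq_div_iff hs.ne' h.ne']
        linear_combination (k + 1 : ℝ) * h2

variable {X : Type*} [MeasurableSpace X]

theorem measurable_measureReal {A : Set X} (hA : MeasurableSet A) :
    Measurable fun Q : Measure X => Q.real A :=
  (Measure.measurable_coe hA).ennreal_toReal

/-- The two-block partition into `A` and its complement suffices; the constant is `k + 1` with `k =
2`. -/
theorem IsDirichletProcess.integral_abs_sub_le {m : Measure X} [IsProbabilityMeasure m] {s : ℝ}
    (hs : 0 < s) {D : Measure (Measure X)} (hD : IsDirichletProcess m s D) {A : Set X}
    (hA : MeasurableSet A) :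
    ∫ Q, |Q.real A - m.real A| ∂D ≤ 3 / √s := by
  have hB : ∀ i, MeasurableSet ((![A, Aᶜ] : Fin 2 → Set X) i) := by
    intro i; fin_cases i
    exacts [hA, hA.compl]
  have h := hD.map_partition 2 ![A, Aᶜ] hB
    (by
      intro i j hij
      fin_cases i <;> fin_cases j <;> simp_all [disjoint_compl_right, disjoint_compl_left])
    (by
      ext x
      simp only [Set.mem_iUnion, Fin.exists_fin_two, Set.mem_univ, iff_true]
      exact em (x ∈ A))
  have h2 := integral_abs_dirichletDist_sub_le
    (a := fun i => s * m.real ((![A, Aᶜ] : Fin 2 → Set X) i))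
    (fun i => mul_nonneg hs.le measureReal_nonneg) hs
    (by simp [Fin.sum_univ_two, probReal_compl_eq_one_sub hA, ← mul_add]) 0
  rw [← h, integral_map (measurable_pi_lambda _ fun i => measurable_measureReal (hB i)).aemeasurable
    (Continuous.aestronglyMeasurable (by fun_prop))] at h2
  simp only [Matrix.cons_val_zero, mul_div_cancel_left₀ _ hs.ne'] at h2
  refine h2.trans_eq ?_
  norm_num

/-! ### Stick-breaking weights -/

theorem sum_stickWeight (v : ℕ → ℝ) (N : ℕ) :
    ∑ i ∈ Finset.range N, stickWeight v i = 1 - ∏ j ∈ Finset.range N, (1 - v j) := by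
  induction N with
  | zero => simp
  | succ N ih => rw [Finset.sum_range_succ, Finset.prod_range_succ, ih, stickWeight]; ring

theorem stickRemainder_mem_Icc {v : ℕ → ℝ} (hv : ∀ i, v i ∈ Set.Icc (0 : ℝ) 1) (N : ℕ) :
    ∏ j ∈ Finset.range N, (1 - v j) ∈ Set.Icc (0 : ℝ) 1 :=
  ⟨Finset.prod_nonneg fun j _ => sub_nonneg.2 (hv j).2,
    Finset.prod_le_one (fun j _ => sub_nonneg.2 (hv j).2) fun j _ => by linarith [(hv j).1]⟩

theorem stickWeight_mem_Icc {v : ℕ → ℝ} (hv : ∀ i, v i ∈ Set.Icc (0 : ℝ) 1) (i : ℕ) :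
    stickWeight v i ∈ Set.Icc (0 : ℝ) 1 :=
  ⟨mul_nonneg (hv i).1 (stickRemainder_mem_Icc hv i).1,
    mul_le_one₀ (hv i).2 (stickRemainder_mem_Icc hv i).1 (stickRemainder_mem_Icc hv i).2⟩

theorem measurable_stickWeight (i : ℕ) : Measurable fun v => stickWeight v i := by
  unfold stickWeight
  fun_prop

theorem integral_eval_infinitePi {Ω : Type*} [MeasurableSpace Ω] (μ : Measure Ω)
    [IsProbabilityMeasure μ] (i : ℕ) {f : Ω → ℝ} (hf : Measurable f) :
    ∫ v, f (v i) ∂(Measure.infinitePi fun _ : ℕ => μ) = ∫ x, f x ∂μ := by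
  conv_rhs => rw [← Measure.infinitePi_map_eval (fun _ : ℕ => μ) i]
  rw [integral_map (measurable_pi_apply i).aemeasurable hf.aestronglyMeasurable]

theorem integral_prod_range_infinitePi {Ω : Type*} [MeasurableSpace Ω] (μ : Measure Ω)
    [IsProbabilityMeasure μ] (N : ℕ) {f : ℕ → Ω → ℝ} (hf : ∀ j, Measurable (f j)) :
    ∫ v, ∏ j ∈ Finset.range N, f j (v j) ∂(Measure.infinitePi fun _ : ℕ => μ) =
      ∏ j ∈ Finset.range N, ∫ x, f j x ∂μ := by
  have h := (iIndepFun_infinitePi (P := fun _ : ℕ => μ) (X := f) hf).precomp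
    (Fin.val_injective (n := N))
  have h2 := h.integral_fun_prod_eq_prod_integral (fun i => by
    exact ((hf i).comp (measurable_pi_apply _)).aestronglyMeasurable)
  simp_rw [Finset.prod_range]
  refine h2.trans (Finset.prod_congr rfl fun i _ => ?_)
  exact integral_eval_infinitePi μ i (hf i)

theorem ae_mem_Icc_infinitePi_beta {s : ℝ} (hs : 0 < s) :
    ∀ᵐ v ∂(Measure.infinitePi fun _ : ℕ => betaMeasure 1 s), ∀ i, v i ∈ Set.Icc (0 : ℝ) 1 := by
  have := isProbabilityMeasureBeta one_pos hs
  rw [ae_all_iff]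
  intro i
  have h := (measurePreserving_eval_infinitePi (fun _ : ℕ => betaMeasure 1 s) i
    ).quasiMeasurePreserving.ae (ae_mem_Ioo_betaMeasure 1 s)
  filter_upwards [h] with v hv using Set.Ioo_subset_Icc_self hv

theorem integral_stickRemainder {s : ℝ} (hs : 0 < s) (N : ℕ) :
    ∫ v, ∏ j ∈ Finset.range N, (1 - v j) ∂(Measure.infinitePi fun _ : ℕ => betaMeasure 1 s) =
      (s / (s + 1)) ^ N := by
  have := isProbabilityMeasureBeta one_pos hs
  rw [integral_prod_range_infinitePi (betaMeasure 1 s) N (f := fun _ x => 1 - x)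
    fun _ => by fun_prop]
  rw [betaMeasure_moment_one hs, Finset.prod_const, Finset.card_range]

theorem integral_stickWeight_sq {s : ℝ} (hs : 0 < s) (i : ℕ) :
    ∫ v, stickWeight v i ^ 2 ∂(Measure.infinitePi fun _ : ℕ => betaMeasure 1 s) =
      ((s / (s + 2)) ^ i - (s / (s + 2)) ^ (i + 1)) / (s + 1) := by
  have := isProbabilityMeasureBeta one_pos hs
  -- The squared weight is a product over `range (i + 1)` of functions of single coordinates, the
  -- last factor being `x ^ 2` and the earlier ones `(1 - x) ^ 2`.
  have h := integral_prod_range_infinitePi (betaMeasure 1 s) (i + 1)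
    (f := fun j x => if j = i then x ^ 2 else (1 - x) ^ 2) fun j => by
      split_ifs <;> fun_prop
  have hne : ∀ j ∈ Finset.range i, j ≠ i := fun j hj => (Finset.mem_range.1 hj).ne
  simp_rw [Finset.prod_range_succ, if_true] at h
  rw [Finset.prod_congr rfl fun j hj => by rw [integral_congr_ae (ae_of_all _ fun x => by
    rw [if_neg (hne j hj)]), betaMeasure_moment_two hs]] at h
  rw [betaMeasure_second_moment hs] at h
  have h3 : ∀ v : ℕ → ℝ, stickWeight v i ^ 2 =
      (∏ j ∈ Finset.range i, if j = i then v j ^ 2 else (1 - v j) ^ 2) * v i ^ 2 := by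
    intro v
    rw [stickWeight, Finset.prod_congr rfl fun j hj => if_neg (hne j hj), Finset.prod_pow]
    ring
  simp_rw [h3]
  rw [h, Finset.prod_const, Finset.card_range]
  ring

theorem integrable_of_ae_bound_stick {s : ℝ} (hs : 0 < s) {f : (ℕ → ℝ) → ℝ} (hf : Measurable f)
    (h : ∀ v : ℕ → ℝ, (∀ i, v i ∈ Set.Icc (0 : ℝ) 1) → f v ∈ Set.Icc (0 : ℝ) 1) :
    Integrable f (Measure.infinitePi fun _ : ℕ => betaMeasure 1 s) := by
  have := isProbabilityMeasureBeta one_pos hs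
  refine Integrable.of_bound hf.aestronglyMeasurable 1 ?_
  filter_upwards [ae_mem_Icc_infinitePi_beta hs] with v hv
  rw [Real.norm_of_nonneg (h v hv).1]
  exact (h v hv).2

theorem integrable_stickRemainder {s : ℝ} (hs : 0 < s) (N : ℕ) :
    Integrable (fun v : ℕ → ℝ => ∏ j ∈ Finset.range N, (1 - v j))
      (Measure.infinitePi fun _ : ℕ => betaMeasure 1 s) :=
  integrable_of_ae_bound_stick hs (by fun_prop) fun _ hv => stickRemainder_mem_Icc hv N

/-- The expected remainders form a convergent geometric series, so the series of remainders is
almost surely finite and its terms tend to `0`. -/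
theorem ae_tendsto_stickRemainder {s : ℝ} (hs : 0 < s) :
    ∀ᵐ v ∂(Measure.infinitePi fun _ : ℕ => betaMeasure 1 s),
      Tendsto (fun N => ∏ j ∈ Finset.range N, (1 - v j)) atTop (𝓝 0) := by
  have := isProbabilityMeasureBeta one_pos hs
  have hm : ∀ N, Measurable fun v : ℕ → ℝ => ENNReal.ofReal (∏ j ∈ Finset.range N, (1 - v j)) :=
    fun N => by fun_prop
  have hq0 : 0 ≤ s / (s + 1) := by positivity
  have hq1 : s / (s + 1) < 1 := by rw [div_lt_one (by positivity)]; linarith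
  have hfin : ∫⁻ v, ∑' N, ENNReal.ofReal (∏ j ∈ Finset.range N, (1 - v j))
      ∂(Measure.infinitePi fun _ : ℕ => betaMeasure 1 s) ≠ ∞ := by
    rw [lintegral_tsum fun N => (hm N).aemeasurable]
    have : ∀ N, ∫⁻ v, ENNReal.ofReal (∏ j ∈ Finset.range N, (1 - v j))
        ∂(Measure.infinitePi fun _ : ℕ => betaMeasure 1 s) =
          ENNReal.ofReal ((s / (s + 1)) ^ N) := fun N => by
      rw [← integral_stickRemainder hs, ofReal_integral_eq_lintegral_ofReal
        (integrable_stickRemainder hs N)]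
      filter_upwards [ae_mem_Icc_infinitePi_beta hs] with v hv using (stickRemainder_mem_Icc hv N).1
    simp_rw [this]
    rw [← ENNReal.ofReal_tsum_of_nonneg (fun N => by positivity)
      (summable_geometric_of_lt_one hq0 hq1)]
    exact ENNReal.ofReal_ne_top
  filter_upwards [ae_lt_top (Measurable.tsum hm) hfin, ae_mem_Icc_infinitePi_beta hs]
    with v hv hv1
  have h := ENNReal.tendsto_atTop_zero_of_tsum_ne_top hv.ne
  have h2 := (ENNReal.tendsto_toReal ENNReal.zero_ne_top).comp h
  refine h2.congr fun N => ?_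
  exact ENNReal.toReal_ofReal (stickRemainder_mem_Icc hv1 N).1

/-! ### The stick-breaking measure -/

theorem isProbabilityMeasure_stickMeasure {v : ℕ → ℝ} (hv : ∀ i, v i ∈ Set.Icc (0 : ℝ) 1)
    (h : Tendsto (fun N => ∏ j ∈ Finset.range N, (1 - v j)) atTop (𝓝 0)) (y : ℕ → X) :
    IsProbabilityMeasure (stickMeasure (v, y)) := by
  refine ⟨?_⟩
  have hs : HasSum (stickWeight v) 1 := by
    rw [hasSum_iff_tendsto_nat_of_nonneg fun i => (stickWeight_mem_Icc hv i).1]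
    simp_rw [sum_stickWeight]
    simpa using h.const_sub 1
  simp only [stickMeasure, Measure.sum_apply _ MeasurableSet.univ, Measure.smul_apply,
    measure_univ, smul_eq_mul, mul_one]
  rw [← ENNReal.ofReal_tsum_of_nonneg (fun i => (stickWeight_mem_Icc hv i).1) hs.summable,
    hs.tsum_eq, ENNReal.ofReal_one]

theorem sum_stickWeight_indicator_le {v : ℕ → ℝ} (hv : ∀ i, v i ∈ Set.Icc (0 : ℝ) 1) (y : ℕ → X)
    [IsProbabilityMeasure (stickMeasure (v, y))] {A : Set X} (hA : MeasurableSet A) (N : ℕ) :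
    ∑ i ∈ Finset.range N, stickWeight v i * A.indicator 1 (y i) ≤
      (stickMeasure (v, y)).real A := by
  have h0 : ∀ i, 0 ≤ stickWeight v i * A.indicator (1 : X → ℝ) (y i) := fun i =>
    mul_nonneg (stickWeight_mem_Icc hv i).1 (Set.indicator_nonneg (fun _ _ => zero_le_one) _)
  rw [measureReal_def, ← ENNReal.ofReal_le_iff_le_toReal (measure_ne_top _ _),
    ENNReal.ofReal_sum_of_nonneg fun i _ => h0 i, stickMeasure, Measure.sum_apply _ hA]
  refine le_trans (Finset.sum_le_sum fun i _ => ?_) (ENNReal.sum_le_tsum (Finset.range N))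
  rw [ENNReal.ofReal_mul (stickWeight_mem_Icc hv i).1, Measure.smul_apply, smul_eq_mul,
    Measure.dirac_apply' _ hA]
  by_cases h : y i ∈ A <;> simp [h]

/-- Truncated sums bound the masses of `A` and `Aᶜ` from below and together account for all but the
remainder `R` of the unit mass. Hence the mass of `A` exceeds its truncated sum by at most `R`. -/
theorem abs_stickMeasure_sub_le {v : ℕ → ℝ} (hv : ∀ i, v i ∈ Set.Icc (0 : ℝ) 1)
    (h : Tendsto (fun N => ∏ j ∈ Finset.range N, (1 - v j)) atTop (𝓝 0)) (y : ℕ → X)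
    {A : Set X} (hA : MeasurableSet A) {p : ℝ} (hp : p ∈ Set.Icc (0 : ℝ) 1) (N : ℕ) :
    |(stickMeasure (v, y)).real A - p| ≤
      |∑ i ∈ Finset.range N, stickWeight v i * (A.indicator 1 (y i) - p)| +
        ∏ j ∈ Finset.range N, (1 - v j) := by
  have := isProbabilityMeasure_stickMeasure hv h y
  have h1 := sum_stickWeight_indicator_le hv y hA N
  have h2 := sum_stickWeight_indicator_le hv y hA.compl N
  rw [probReal_compl_eq_one_sub hA] at h2
  have h3 : ∑ i ∈ Finset.range N, stickWeight v i * A.indicator 1 (y i) +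
      ∑ i ∈ Finset.range N, stickWeight v i * Aᶜ.indicator 1 (y i) =
        1 - ∏ j ∈ Finset.range N, (1 - v j) := by
    rw [← sum_stickWeight, ← Finset.sum_add_distrib]
    refine Finset.sum_congr rfl fun i _ => ?_
    by_cases h : y i ∈ A <;> simp [h]
  have h4 : ∑ i ∈ Finset.range N, stickWeight v i * (A.indicator 1 (y i) - p) =
      ∑ i ∈ Finset.range N, stickWeight v i * A.indicator 1 (y i) -
        (1 - ∏ j ∈ Finset.range N, (1 - v j)) * p := by
    rw [← sum_stickWeight, Finset.sum_mul, ← Finset.sum_sub_distrib]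
    exact Finset.sum_congr rfl fun i _ => by ring
  have hR := (stickRemainder_mem_Icc hv N).1
  have hRp := mul_le_of_le_one_right hR hp.2
  have hRp0 := mul_nonneg hR hp.1
  rw [h4]
  generalize ∑ i ∈ Finset.range N, stickWeight v i * A.indicator 1 (y i) = T at *
  generalize ∏ j ∈ Finset.range N, (1 - v j) = R at *
  -- The second bracket is a difference of two numbers in `[0, R]`.
  have e : (stickMeasure (v, y)).real A - p =
      (T - (1 - R) * p) + ((stickMeasure (v, y)).real A - T - R * p) := by ring
  rw [e]
  refine (abs_add_le _ _).trans (add_le_add le_rfl (abs_le.2 ⟨?_, ?_⟩)) <;> linarith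

/-- The atoms are i.i.d. and independent of the weights, and the indicator is centred, so cross
terms vanish. The diagonal is at most the sum of the second moments of the weights, which
telescopes. -/
theorem integral_sq_sum_stickWeight_le (m : Measure X) [IsProbabilityMeasure m] {s : ℝ}
    (hs : 0 < s) {A : Set X} (hA : MeasurableSet A) (N : ℕ) :
    ∫ p, (∑ i ∈ Finset.range N, stickWeight p.1 i * (A.indicator 1 (p.2 i) - m.real A)) ^ 2
      ∂((Measure.infinitePi fun _ : ℕ => betaMeasure 1 s).prod
        (Measure.infinitePi fun _ : ℕ => m)) ≤ 1 / (s + 1) := by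
  have := isProbabilityMeasureBeta one_pos hs
  set B := Measure.infinitePi fun _ : ℕ => betaMeasure 1 s
  set Y := Measure.infinitePi fun _ : ℕ => m
  set z : X → ℝ := fun x => A.indicator 1 x - m.real A with hz
  have hzm : Measurable z := (measurable_one.indicator hA).sub_const _
  have hz1 : ∀ x, |z x| ≤ 1 := fun x => by
    have h0 : 0 ≤ m.real A := measureReal_nonneg
    have h1 : m.real A ≤ 1 := measureReal_le_one
    rw [abs_le]
    by_cases h : x ∈ A <;> simp [hz, h] <;> linarith
  have hz0 : ∫ x, z x ∂m = 0 := by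
    have hi : Integrable (A.indicator (1 : X → ℝ)) m :=
      (integrable_const (1 : ℝ)).indicator hA
    simp only [hz]
    rw [integral_sub hi (integrable_const _), integral_indicator_one hA]
    simp
  have hzz : ∀ i j, Integrable (fun y : ℕ → X => z (y i) * z (y j)) Y := fun i j =>
    Integrable.of_bound (Measurable.aestronglyMeasurable (by fun_prop)) 1
      (ae_of_all _ fun y => by
        rw [norm_mul]
        exact mul_le_one₀ (hz1 _) (norm_nonneg _) (hz1 _))
  have hww : ∀ i j, Integrable (fun v : ℕ → ℝ => stickWeight v i * stickWeight v j) B :=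
    fun i j => integrable_of_ae_bound_stick hs
      ((measurable_stickWeight i).mul (measurable_stickWeight j)) fun v hv =>
        ⟨mul_nonneg (stickWeight_mem_Icc hv i).1 (stickWeight_mem_Icc hv j).1,
          mul_le_one₀ (stickWeight_mem_Icc hv i).2 (stickWeight_mem_Icc hv j).1
            (stickWeight_mem_Icc hv j).2⟩
  have hoff : ∀ i j, i ≠ j → ∫ y : ℕ → X, z (y i) * z (y j) ∂Y = 0 := fun i j hij => by
    have h := (iIndepFun_infinitePi (P := fun _ : ℕ => m) (X := fun _ => z)
      fun _ => hzm).indepFun hij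
    rw [h.integral_fun_mul_eq_mul_integral (Measurable.aestronglyMeasurable (by fun_prop))
      (Measurable.aestronglyMeasurable (by fun_prop))]
    rw [integral_eval_infinitePi m i hzm, hz0, zero_mul]
  have hdiag : ∀ i, ∫ y : ℕ → X, z (y i) * z (y i) ∂Y ≤ 1 := fun i => by
    refine (integral_mono (hzz i i) (integrable_const 1) fun y => ?_).trans_eq (by simp)
    have := hz1 (y i)
    rw [← sq, ← sq_abs]
    exact pow_le_one₀ (abs_nonneg _) this
  have hexp : ∀ p : (ℕ → ℝ) × (ℕ → X),
      (∑ i ∈ Finset.range N, stickWeight p.1 i * z (p.2 i)) ^ 2 =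
        ∑ i ∈ Finset.range N, ∑ j ∈ Finset.range N,
          (stickWeight p.1 i * stickWeight p.1 j) * (z (p.2 i) * z (p.2 j)) := fun p => by
    rw [sq, Finset.sum_mul_sum]
    exact Finset.sum_congr rfl fun i _ => Finset.sum_congr rfl fun j _ => by ring
  have hint : ∀ i j, Integrable (fun p : (ℕ → ℝ) × (ℕ → X) =>
      (stickWeight p.1 i * stickWeight p.1 j) * (z (p.2 i) * z (p.2 j))) (B.prod Y) :=
    fun i j => (hww i j).mul_prod (hzz i j)
  calc ∫ p, (∑ i ∈ Finset.range N, stickWeight p.1 i * z (p.2 i)) ^ 2 ∂(B.prod Y)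
      = ∑ i ∈ Finset.range N, ∑ j ∈ Finset.range N,
          (∫ v, stickWeight v i * stickWeight v j ∂B) * ∫ y, z (y i) * z (y j) ∂Y := by
        simp_rw [hexp]
        rw [integral_finsetSum _ fun i _ => integrable_finsetSum _ fun j _ => hint i j]
        refine Finset.sum_congr rfl fun i _ => ?_
        rw [integral_finsetSum _ fun j _ => hint i j]
        exact Finset.sum_congr rfl fun j _ => integral_prod_mul
          (fun v => stickWeight v i * stickWeight v j) fun y : ℕ → X => z (y i) * z (y j)
    _ = ∑ i ∈ Finset.range N,
          (∫ v, stickWeight v i * stickWeight v i ∂B) * ∫ y, z (y i) * z (y i) ∂Y := by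
        refine Finset.sum_congr rfl fun i hi => Finset.sum_eq_single_of_mem i hi fun j _ hj => ?_
        rw [hoff i j hj.symm, mul_zero]
    _ ≤ ∑ i ∈ Finset.range N, ∫ v, stickWeight v i ^ 2 ∂B := by
        refine Finset.sum_le_sum fun i _ => ?_
        simp_rw [sq]
        exact mul_le_of_le_one_right (integral_nonneg fun v => mul_self_nonneg _) (hdiag i)
    _ = (1 - (s / (s + 2)) ^ N) / (s + 1) := by
        simp_rw [B, integral_stickWeight_sq hs]
        rw [← Finset.sum_div, Finset.sum_range_sub', pow_zero]
    _ ≤ 1 / (s + 1) := by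
        gcongr
        linarith [show 0 ≤ (s / (s + 2)) ^ N by positivity]

theorem ae_stickBreaking {s : ℝ} (hs : 0 < s) (m : Measure X) [IsProbabilityMeasure m] :
    ∀ᵐ p ∂((Measure.infinitePi fun _ : ℕ => betaMeasure 1 s).prod
        (Measure.infinitePi fun _ : ℕ => m)),
      (∀ i, p.1 i ∈ Set.Icc (0 : ℝ) 1) ∧
        Tendsto (fun N => ∏ j ∈ Finset.range N, (1 - p.1 j)) atTop (𝓝 0) := by
  have := isProbabilityMeasureBeta one_pos hs
  exact Measure.quasiMeasurePreserving_fst.ae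
    ((ae_mem_Icc_infinitePi_beta hs).and (ae_tendsto_stickRemainder hs))

theorem measurableSet_isProbabilityMeasure :
    MeasurableSet {Q : Measure X | IsProbabilityMeasure Q} := by
  have : {Q : Measure X | IsProbabilityMeasure Q} = (fun Q => Q Set.univ) ⁻¹' {1} := by
    ext Q
    exact isProbabilityMeasure_iff
  rw [this]
  exact Measure.measurable_coe MeasurableSet.univ (measurableSet_singleton 1)

theorem ae_isProbabilityMeasure_stickBreakingLaw {s : ℝ} (hs : 0 < s) (m : Measure X)
    [IsProbabilityMeasure m] : ∀ᵐ Q ∂(stickBreakingLaw m s), IsProbabilityMeasure Q := by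
  rw [stickBreakingLaw, ae_map_iff measurable_stickMeasure.aemeasurable
    measurableSet_isProbabilityMeasure]
  filter_upwards [ae_stickBreaking hs m] with p hp
  exact isProbabilityMeasure_stickMeasure hp.1 hp.2 p.2

theorem integral_abs_stickBreakingLaw_sub_le {s : ℝ} (hs : 0 < s) (m : Measure X)
    [IsProbabilityMeasure m] {A : Set X} (hA : MeasurableSet A) :
    ∫ Q, |Q.real A - m.real A| ∂(stickBreakingLaw m s) ≤ 3 / √s := by
  have := isProbabilityMeasureBeta one_pos hs
  -- The argument gives `√(1 / (s + 1))` as the truncation level `N` tends to infinity; it is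
  -- relaxed to match the bound of `IsDirichletProcess.integral_abs_sub_le`.
  have hb : √(1 / (s + 1)) ≤ 3 / √s := by
    rw [Real.sqrt_div zero_le_one, Real.sqrt_one]
    gcongr
    · norm_num
    · linarith
  refine le_trans ?_ hb
  have hp : m.real A ∈ Set.Icc (0 : ℝ) 1 := ⟨measureReal_nonneg, measureReal_le_one⟩
  rw [stickBreakingLaw, integral_map measurable_stickMeasure.aemeasurable
    ((measurable_measureReal hA).sub_const _).abs.aestronglyMeasurable]
  have key : ∀ N : ℕ, ∫ p, |(stickMeasure p).real A - m.real A|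
      ∂((Measure.infinitePi fun _ : ℕ => betaMeasure 1 s).prod
        (Measure.infinitePi fun _ : ℕ => m)) ≤ √(1 / (s + 1)) + (s / (s + 1)) ^ N := by
    intro N
    have hSm : Measurable fun p : (ℕ → ℝ) × (ℕ → X) =>
        ∑ i ∈ Finset.range N, stickWeight p.1 i * (A.indicator 1 (p.2 i) - m.real A) := by
      refine Finset.measurable_fun_sum _ fun i _ => ?_
      refine ((measurable_stickWeight i).comp measurable_fst).mul (Measurable.sub_const ?_ _)
      exact (measurable_one.indicator hA).comp (by fun_prop)
    have hSL : MemLp (fun p : (ℕ → ℝ) × (ℕ → X) =>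
        ∑ i ∈ Finset.range N, stickWeight p.1 i * (A.indicator 1 (p.2 i) - m.real A)) 2
        ((Measure.infinitePi fun _ : ℕ => betaMeasure 1 s).prod
          (Measure.infinitePi fun _ : ℕ => m)) := by
      refine MemLp.of_bound hSm.aestronglyMeasurable (N * 1) ?_
      filter_upwards [ae_stickBreaking hs m] with p h
      refine (norm_sum_le _ _).trans ((Finset.sum_le_card_nsmul _ _ 1 fun i _ => ?_).trans_eq
        (by simp))
      have hw := stickWeight_mem_Icc h.1 i
      rw [norm_mul, Real.norm_of_nonneg hw.1]
      refine mul_le_one₀ hw.2 (norm_nonneg _) (abs_le.2 ?_)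
      by_cases hx : p.2 i ∈ A <;> simp [hx] <;> linarith [hp.1, hp.2]
    have hRi := (integrable_stickRemainder hs N).comp_fst (ν := Measure.infinitePi fun _ : ℕ => m)
    have hRe : ∫ p : (ℕ → ℝ) × (ℕ → X), ∏ j ∈ Finset.range N, (1 - p.1 j)
        ∂((Measure.infinitePi fun _ : ℕ => betaMeasure 1 s).prod
          (Measure.infinitePi fun _ : ℕ => m)) = (s / (s + 1)) ^ N := by
      rw [integral_fun_fst (fun v : ℕ → ℝ => ∏ j ∈ Finset.range N, (1 - v j)),
        integral_stickRemainder hs]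
      simp
    have hSi := hSL.abs.integrable one_le_two
    refine (integral_mono_of_nonneg (ae_of_all _ fun _ => abs_nonneg _) (hSi.add hRi) ?_).trans ?_
    · filter_upwards [ae_stickBreaking hs m] with p h
      exact abs_stickMeasure_sub_le h.1 h.2 p.2 hA hp N
    · have e := integral_add hSi hRi
      refine e.trans_le ?_
      rw [hRe]
      gcongr
      refine (integral_abs_le_sqrt_integral_sq hSL).trans (Real.sqrt_le_sqrt ?_)
      exact integral_sq_sum_stickWeight_le m hs hA N
  have hlim : Tendsto (fun N : ℕ => √(1 / (s + 1)) + (s / (s + 1)) ^ N) atTop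
      (𝓝 (√(1 / (s + 1)) + 0)) := by
    refine tendsto_const_nhds.add (tendsto_pow_atTop_nhds_zero_of_lt_one (by positivity) ?_)
    rw [div_lt_one (by positivity)]
    linarith
  rw [add_zero] at hlim
  exact ge_of_tendsto' hlim key

/-! ### Total variation distance on a countable space -/

theorem bddAbove_tvDist (Q P : Measure X) [IsFiniteMeasure Q] [IsFiniteMeasure P] :
    BddAbove (Set.range fun C : Set X => |Q.real C - P.real C|) := by
  refine ⟨Q.real Set.univ + P.real Set.univ, ?_⟩
  rintro _ ⟨C, rfl⟩
  have h1 : Q.real C ≤ Q.real Set.univ := measureReal_mono (Set.subset_univ C)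
  have h2 : P.real C ≤ P.real Set.univ := measureReal_mono (Set.subset_univ C)
  have h3 : 0 ≤ Q.real C := measureReal_nonneg
  have h4 : 0 ≤ P.real C := measureReal_nonneg
  exact abs_le.2 ⟨by linarith, by linarith⟩

theorem tvDist_nonneg (Q P : Measure X) : 0 ≤ tvDist Q P :=
  Real.iSup_nonneg fun _ => abs_nonneg _

theorem tendsto_measureReal_finset [Countable X] (Q : Measure X) [IsFiniteMeasure Q] (C : Set X) :
    Tendsto (fun F : Finset X => Q.real (C ∩ F)) atTop (𝓝 (Q.real C)) := by
  have hmono : Monotone fun F : Finset X => C ∩ (F : Set X) := fun F G h =>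
    Set.inter_subset_inter_right C (Finset.coe_subset.2 h)
  have h := tendsto_measure_iUnion_atTop (μ := Q) hmono
  have hU : (⋃ F : Finset X, C ∩ (F : Set X)) = C := by
    ext x
    simp only [Set.mem_iUnion, Set.mem_inter_iff, exists_and_left, and_iff_left_iff_imp]
    exact fun _ => ⟨{x}, by simp⟩
  rw [hU] at h
  exact (ENNReal.tendsto_toReal (measure_ne_top Q C)).comp h

/-- There are only countably many finite sets, which makes the supremum measurable in `Q`; every `C`
is reached from its finite parts by continuity from below. -/
theorem tvDist_eq_iSup_finset [Countable X] (Q P : Measure X) [IsFiniteMeasure Q]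
    [IsFiniteMeasure P] :
    tvDist Q P = ⨆ F : Finset X, |Q.real (F : Set X) - P.real (F : Set X)| := by
  classical
  have hb : BddAbove (Set.range fun F : Finset X => |Q.real (F : Set X) - P.real (F : Set X)|) :=
    (bddAbove_tvDist Q P).mono (by rintro _ ⟨F, rfl⟩; exact ⟨F, rfl⟩)
  refine le_antisymm (ciSup_le fun C => ?_) (ciSup_le fun F => le_ciSup (bddAbove_tvDist Q P) _)
  refine le_of_tendsto' ((tendsto_measureReal_finset Q C).sub
    (tendsto_measureReal_finset P C)).abs fun F => ?_
  have : C ∩ (F : Set X) = ((F.filter (· ∈ C) : Finset X) : Set X) := by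
    ext x
    simp [and_comm]
  rw [this]
  exact le_ciSup hb (F.filter (· ∈ C))

/-- Measurability is only almost everywhere because the reduction to finite sets requires `Q` to be
finite. -/
theorem aemeasurable_tvDist [Countable X] [MeasurableSingletonClass X] {D : Measure (Measure X)}
    (hD : ∀ᵐ Q ∂D, IsProbabilityMeasure Q) (P : Measure X) [IsFiniteMeasure P] :
    AEMeasurable (fun Q => tvDist Q P) D := by
  refine ⟨fun Q => ⨆ F : Finset X, |Q.real (F : Set X) - P.real (F : Set X)|, ?_, ?_⟩
  · exact Measurable.iSup fun F =>
      ((measurable_measureReal F.measurableSet).sub_const _).abs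
  · filter_upwards [hD] with Q hQ using tvDist_eq_iSup_finset Q P

theorem abs_sub_le_sum_singleton [MeasurableSingletonClass X] (Q m : Measure X)
    [IsFiniteMeasure Q] [IsFiniteMeasure m] (F : Finset X) :
    |Q.real F - m.real F| ≤ ∑ x ∈ F, |Q.real {x} - m.real {x}| := by
  rw [← sum_measureReal_singleton, ← sum_measureReal_singleton, ← Finset.sum_sub_distrib]
  exact Finset.abs_sum_le_sum_abs _ _

/-- `C` is split along `F`. As both total masses are `1`, `Q(Fᶜ)` exceeds `m(Fᶜ)` by at most the sum
over `F`, so no separate tail bound for `Q` is needed. -/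
theorem abs_measureReal_sub_le [MeasurableSingletonClass X] (Q m : Measure X)
    [IsProbabilityMeasure Q] [IsProbabilityMeasure m] (F : Finset X) (C : Set X) :
    |Q.real C - m.real C| ≤
      2 * ∑ x ∈ F, |Q.real {x} - m.real {x}| + 2 * m.real (F : Set X)ᶜ := by
  classical
  have hC : C ∩ (F : Set X) = ((F.filter (· ∈ C) : Finset X) : Set X) := by
    ext x
    simp [and_comm]
  have h1 : |Q.real (C ∩ F) - m.real (C ∩ F)| ≤ ∑ x ∈ F, |Q.real {x} - m.real {x}| := by
    rw [hC]
    exact (abs_sub_le_sum_singleton Q m _).trans (Finset.sum_le_sum_of_subset_of_nonneg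
      (Finset.filter_subset _ _) fun _ _ _ => abs_nonneg _)
  have h2 := (abs_le.1 (abs_sub_le_sum_singleton Q m F)).1
  have hQ := probReal_compl_eq_one_sub (μ := Q) F.measurableSet
  have hm := probReal_compl_eq_one_sub (μ := m) F.measurableSet
  have hQ2 := measureReal_inter_add_sdiff (μ := Q) (s := C) F.measurableSet
  have hm2 := measureReal_inter_add_sdiff (μ := m) (s := C) F.measurableSet
  have hQ3 : Q.real (C \ F) ≤ Q.real (F : Set X)ᶜ := measureReal_mono fun x hx => hx.2
  have hm3 : m.real (C \ F) ≤ m.real (F : Set X)ᶜ := measureReal_mono fun x hx => hx.2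
  have hQ4 : 0 ≤ Q.real (C \ F) := measureReal_nonneg
  have hm4 : 0 ≤ m.real (C \ F) := measureReal_nonneg
  have h5 := abs_le.1 h1
  exact abs_le.2 ⟨by linarith [h5.1], by linarith [h5.2]⟩

/-! ### Empirical measure and posterior mean -/

theorem theta_mem_Icc {M : ℝ} (hM : 0 < M) (n : ℕ) : theta M n ∈ Set.Icc (0 : ℝ) 1 := by
  have hn : (0 : ℝ) ≤ n := n.cast_nonneg
  unfold theta
  refine ⟨by positivity, ?_⟩
  rw [div_le_one (by positivity)]
  linarith

theorem tendsto_theta (M : ℝ) : Tendsto (theta M) atTop (𝓝 0) :=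
  tendsto_const_nhds.div_atTop
    (tendsto_atTop_add_const_left _ M tendsto_natCast_atTop_atTop)

theorem isProbabilityMeasure_empirical (x : ℕ → X) {n : ℕ} (hn : n ≠ 0) :
    IsProbabilityMeasure (empirical x n) :=
  ⟨by simp [empirical, ENNReal.inv_mul_cancel, hn]⟩

instance isFiniteMeasure_empirical (x : ℕ → X) (n : ℕ) : IsFiniteMeasure (empirical x n) := by
  rcases eq_or_ne n 0 with rfl | hn
  · simp only [empirical, Finset.range_zero, Finset.sum_empty, smul_zero]
    infer_instance
  · have := isProbabilityMeasure_empirical x hn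
    infer_instance

theorem empirical_real (x : ℕ → X) (n : ℕ) {A : Set X} (hA : MeasurableSet A) :
    (empirical x n).real A = (∑ i ∈ Finset.range n, A.indicator 1 (x i)) / n := by
  rw [empirical, measureReal_ennreal_smul_apply, measureReal_def, Measure.finsetSum_apply,
    ENNReal.toReal_sum fun i _ => measure_ne_top _ _, div_eq_inv_mul, ENNReal.toReal_inv,
    ENNReal.toReal_natCast]
  congr 1
  refine Finset.sum_congr rfl fun i _ => ?_
  rw [Measure.dirac_apply' _ hA]
  by_cases h : x i ∈ A <;> simp [h]

theorem posteriorMean_real (α : Measure X) [IsFiniteMeasure α] {M : ℝ} (hM : 0 < M) (x : ℕ → X)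
    (n : ℕ) (A : Set X) :
    (posteriorMean α M x n).real A =
      theta M n * α.real A + (1 - theta M n) * (empirical x n).real A := by
  have h := theta_mem_Icc hM n
  simp only [measureReal_def, posteriorMean, Measure.add_apply, Measure.smul_apply, smul_eq_mul]
  rw [ENNReal.toReal_add (ENNReal.mul_ne_top ENNReal.ofReal_ne_top (measure_ne_top _ _))
    (ENNReal.mul_ne_top ENNReal.ofReal_ne_top (measure_ne_top _ _)), ENNReal.toReal_mul,
    ENNReal.toReal_mul, ENNReal.toReal_ofReal h.1, ENNReal.toReal_ofReal (sub_nonneg.2 h.2)]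

theorem abs_posteriorMean_sub_empirical_le (α : Measure X) [IsProbabilityMeasure α] {M : ℝ}
    (hM : 0 < M) (x : ℕ → X) {n : ℕ} (hn : n ≠ 0) (A : Set X) :
    |(posteriorMean α M x n).real A - (empirical x n).real A| ≤ theta M n := by
  have := isProbabilityMeasure_empirical x hn
  have h := theta_mem_Icc hM n
  have h1 : α.real A ≤ 1 := measureReal_le_one
  have h2 : (empirical x n).real A ≤ 1 := measureReal_le_one
  have h3 : 0 ≤ α.real A := measureReal_nonneg
  have h4 : 0 ≤ (empirical x n).real A := measureReal_nonneg
  rw [posteriorMean_real α hM, show theta M n * α.real A + (1 - theta M n) *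
    (empirical x n).real A - (empirical x n).real A =
      theta M n * (α.real A - (empirical x n).real A) by ring, abs_mul, abs_of_nonneg h.1]
  exact mul_le_of_le_one_right h.1 (abs_le.2 ⟨by linarith, by linarith⟩)

theorem ae_tendsto_empirical (P : Measure X) [IsProbabilityMeasure P] {A : Set X}
    (hA : MeasurableSet A) :
    ∀ᵐ x ∂(Measure.infinitePi fun _ : ℕ => P),
      Tendsto (fun n => (empirical x n).real A) atTop (𝓝 (P.real A)) := by
  have hm : Measurable (A.indicator (1 : X → ℝ)) := measurable_one.indicator hA
  have hmi : ∀ i, Measurable fun x : ℕ → X => A.indicator (1 : X → ℝ) (x i) := fun i => by fun_prop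
  have h := strong_law_ae_real (μ := Measure.infinitePi fun _ : ℕ => P)
    (fun i x => A.indicator (1 : X → ℝ) (x i)) ?_ ?_ ?_
  · rw [integral_eval_infinitePi P 0 hm, integral_indicator_one hA] at h
    filter_upwards [h] with x hx
    exact hx.congr fun n => (empirical_real x n hA).symm
  · refine Integrable.of_bound (hmi 0).aestronglyMeasurable 1 (ae_of_all _ fun x => ?_)
    by_cases h : x 0 ∈ A <;> simp [h]
  · exact fun i j hij => (iIndepFun_infinitePi (P := fun _ : ℕ => P)
      (X := fun _ => A.indicator (1 : X → ℝ)) fun _ => hm).indepFun hij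
  · refine fun i => IdentDistrib.comp (u := A.indicator (1 : X → ℝ))
      (f := fun x : ℕ → X => x i) (g := fun x : ℕ → X => x 0) ?_ hm
    refine ⟨(measurable_pi_apply i).aemeasurable, (measurable_pi_apply 0).aemeasurable, ?_⟩
    exact (Measure.infinitePi_map_eval (fun _ : ℕ => P) i).trans
      (Measure.infinitePi_map_eval (fun _ : ℕ => P) 0).symm

/-! ### Convergence in law -/

/-- Nonnegative random variables with means converging to `0` converge in law to `0`. -/
theorem tendstoInDistribution_zero_of_integral {Ω : ℕ → Type*} [∀ n, MeasurableSpace (Ω n)]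
    (μ : ∀ n, Measure (Ω n)) [∀ n, IsProbabilityMeasure (μ n)] {T : ∀ n, Ω n → ℝ}
    (hT : ∀ n, Integrable (T n) (μ n)) (h0 : ∀ n, 0 ≤ T n)
    (hlim : Tendsto (fun n => ∫ ω, T n ω ∂(μ n)) atTop (𝓝 0)) :
    TendstoInDistribution T atTop (fun _ : Unit => (0 : ℝ)) μ (Measure.dirac ()) := by
  refine ⟨fun n => (hT n).aemeasurable, by fun_prop, ?_⟩
  -- For an `L`-Lipschitz test function `f`, the integral of `f(T_n)` differs from `f(0)` by at most
  -- `L` times the mean of `T_n`.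
  refine tendsto_iff_forall_lipschitz_integral_tendsto.2 ?_
  rintro f ⟨C, hC⟩ ⟨L, hL⟩
  have hfm : Measurable f := hL.continuous.measurable
  change Tendsto (fun n => ∫ t, f t ∂((μ n).map (T n))) atTop
    (𝓝 (∫ t, f t ∂((Measure.dirac ()).map fun _ : Unit => (0 : ℝ))))
  rw [integral_map (by fun_prop) hfm.aestronglyMeasurable, integral_dirac,
    tendsto_iff_dist_tendsto_zero]
  refine squeeze_zero (fun _ => dist_nonneg) (g := fun n => L * ∫ ω, T n ω ∂(μ n)) (fun n => ?_)
    (by simpa using hlim.const_mul (L : ℝ))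
  rw [integral_map (hT n).aemeasurable hfm.aestronglyMeasurable, Real.dist_eq]
  have hfi : Integrable (fun ω => f (T n ω)) (μ n) := by
    refine Integrable.of_bound (hfm.comp_aemeasurable (hT n).aemeasurable).aestronglyMeasurable
      (C + |f 0|) (ae_of_all _ fun ω => ?_)
    have h1 := hC (T n ω) 0
    rw [Real.dist_eq] at h1
    have h2 := abs_add_le (f (T n ω) - f 0) (f 0)
    rw [sub_add_cancel] at h2
    rw [Real.norm_eq_abs]
    linarith
  have hsub : ∫ ω, f (T n ω) ∂(μ n) - f 0 = ∫ ω, (f (T n ω) - f 0) ∂(μ n) := by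
    rw [integral_sub hfi (integrable_const _)]
    simp
  rw [hsub, ← integral_const_mul]
  refine (abs_integral_le_integral_abs).trans (integral_mono (hfi.sub (integrable_const _)).abs
    ((hT n).const_mul _) fun ω => ?_)
  have h := hL.dist_le_mul (T n ω) 0
  rwa [Real.dist_eq, Real.dist_eq, sub_zero, abs_of_nonneg (h0 n ω)] at h

/-- Laws on measures whose evaluations concentrate around the posterior mean are consistent in
total variation. -/
theorem tvTendstoZeroInLaw_of_concentration [Countable X] [MeasurableSingletonClass X]
    (α P : Measure X) [IsProbabilityMeasure α] [IsProbabilityMeasure P] {M : ℝ} (hM : 0 < M)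
    {x : ℕ → X} (hx : ∀ F : Finset X, Tendsto (fun n => (empirical x n).real (F : Set X)ᶜ) atTop
      (𝓝 (P.real (F : Set X)ᶜ)))
    (Post : ℕ → ProbabilityMeasure (Measure X))
    (hprob : ∀ n, ∀ᵐ Q ∂(Post n : Measure (Measure X)), IsProbabilityMeasure Q)
    (hconc : ∀ n y, ∫ Q, |Q.real {y} - (posteriorMean α M x n).real {y}|
      ∂(Post n : Measure (Measure X)) ≤ 3 / √(M + n)) :
    TVTendstoZeroInLaw x Post := by
  have hmp := isProbabilityMeasure_posteriorMean α hM x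
  -- Of the three `θ_n`, one replaces the posterior mean by the empirical measure on `C`, and two do
  -- so in the doubled tail term.
  have hle : ∀ n (F : Finset X), n ≠ 0 → ∀ Q : Measure X, IsProbabilityMeasure Q →
      tvDist Q (empirical x n) ≤
        2 * ∑ y ∈ F, |Q.real {y} - (posteriorMean α M x n).real {y}| +
          (3 * theta M n + 2 * (empirical x n).real (F : Set X)ᶜ) := by
    intro n F hn Q hQ
    refine ciSup_le fun C => ?_
    have := hmp n
    have h1 := abs_measureReal_sub_le Q (posteriorMean α M x n) F C
    have h2 := abs_posteriorMean_sub_empirical_le α hM x hn C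
    have h3 := (abs_le.1 (abs_posteriorMean_sub_empirical_le α hM x hn (F : Set X)ᶜ)).2
    have h4 := abs_sub_le (Q.real C) ((posteriorMean α M x n).real C) ((empirical x n).real C)
    linarith
  have hQi : ∀ n y, Integrable (fun Q : Measure X =>
      |Q.real {y} - (posteriorMean α M x n).real {y}|) (Post n : Measure (Measure X)) := by
    intro n y
    have := hmp n
    refine Integrable.of_bound ((measurable_measureReal
      (measurableSet_singleton y)).sub_const _).abs.aestronglyMeasurable 1 ?_
    filter_upwards [hprob n] with Q hQ
    have h1 : Q.real {y} ≤ 1 := measureReal_le_one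
    have h2 : (posteriorMean α M x n).real {y} ≤ 1 := measureReal_le_one
    have h3 : 0 ≤ Q.real {y} := measureReal_nonneg
    have h4 : 0 ≤ (posteriorMean α M x n).real {y} := measureReal_nonneg
    rw [Real.norm_eq_abs, abs_abs]
    exact abs_le.2 ⟨by linarith, by linarith⟩
  have hTi : ∀ n, Integrable (fun Q : Measure X => tvDist Q (empirical x n))
      (Post n : Measure (Measure X)) := by
    intro n
    -- The bound also covers `n = 0`, where the empirical measure is zero.
    refine Integrable.of_bound (aemeasurable_tvDist (hprob n) _).aestronglyMeasurable
      (1 + (empirical x n).real Set.univ) ?_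
    filter_upwards [hprob n] with Q hQ
    rw [Real.norm_of_nonneg (tvDist_nonneg _ _)]
    refine ciSup_le fun C => ?_
    have h1 : Q.real C ≤ 1 := measureReal_le_one
    have h2 : (empirical x n).real C ≤ (empirical x n).real Set.univ :=
      measureReal_mono (Set.subset_univ C)
    have h3 : 0 ≤ Q.real C := measureReal_nonneg
    have h4 : 0 ≤ (empirical x n).real C := measureReal_nonneg
    exact abs_le.2 ⟨by linarith, by linarith⟩
  have hmean : ∀ n (F : Finset X), n ≠ 0 →
      ∫ Q, tvDist Q (empirical x n) ∂(Post n : Measure (Measure X)) ≤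
        2 * (F.card * (3 / √(M + n))) +
          (3 * theta M n + 2 * (empirical x n).real (F : Set X)ᶜ) := by
    intro n F hn
    have hsi : Integrable (fun Q : Measure X =>
        2 * ∑ y ∈ F, |Q.real {y} - (posteriorMean α M x n).real {y}|)
        (Post n : Measure (Measure X)) :=
      (integrable_finsetSum F fun y _ => hQi n y).const_mul 2
    refine (integral_mono_ae (hTi n) (hsi.add (integrable_const
      (3 * theta M n + 2 * (empirical x n).real (F : Set X)ᶜ))) ?_).trans ?_
    · filter_upwards [hprob n] with Q hQ using hle n F hn Q hQ
    · refine (integral_add hsi (integrable_const _)).trans_le ?_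
      rw [integral_const_mul, integral_finsetSum F fun y _ => hQi n y]
      simp only [integral_const, probReal_univ, smul_eq_mul, one_mul]
      gcongr
      refine (Finset.sum_le_card_nsmul F _ _ fun y _ => hconc n y).trans_eq ?_
      rw [nsmul_eq_mul]
  refine tendstoInDistribution_zero_of_integral _ hTi (fun n Q => tvDist_nonneg _ _) ?_
  rw [Metric.tendsto_atTop']
  intro ε hε
  -- `F` is fixed before `n` grows: in the bound of `hmean`, only the tail term has a possibly
  -- nonzero limit, namely `2 P(Fᶜ)`.
  have hF : ∃ F : Finset X, 2 * P.real (F : Set X)ᶜ < ε := by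
    have h := (tendsto_measureReal_finset P Set.univ).const_sub 1
    simp only [Set.univ_inter, probReal_univ, sub_self] at h
    obtain ⟨F, hF⟩ := (h.eventually (gt_mem_nhds (half_pos hε))).exists
    refine ⟨F, ?_⟩
    rw [probReal_compl_eq_one_sub F.measurableSet]
    linarith
  obtain ⟨F, hF⟩ := hF
  have hsq : Tendsto (fun n : ℕ => 3 / √(M + n)) atTop (𝓝 0) :=
    tendsto_const_nhds.div_atTop (Real.tendsto_sqrt_atTop.comp
      (tendsto_atTop_add_const_left _ M tendsto_natCast_atTop_atTop))
  have hbound : Tendsto (fun n : ℕ => 2 * (F.card * (3 / √(M + n))) +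
      (3 * theta M n + 2 * (empirical x n).real (F : Set X)ᶜ)) atTop
      (𝓝 (2 * (F.card * 0) + (3 * 0 + 2 * P.real (F : Set X)ᶜ))) :=
    ((hsq.const_mul _).const_mul _).add (((tendsto_theta M).const_mul _).add ((hx F).const_mul _))
  simp only [mul_zero, zero_add] at hbound
  obtain ⟨N, hN⟩ := ((hbound.eventually (gt_mem_nhds hF)).and
    (eventually_ne_atTop 0)).exists_forall_of_atTop
  refine ⟨N, fun n hn => ?_⟩
  obtain ⟨h1, h2⟩ := hN n hn.le
  rw [Real.dist_eq, sub_zero, abs_of_nonneg (integral_nonneg fun Q => tvDist_nonneg _ _)]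
  exact (hmean n F h2).trans_lt h1

end DirichletPosterior

/-- Posterior consistency of the Dirichlet process prior in total variation, on a countable space,
for almost every i.i.d. data sequence `x`. The posterior is `DP(α_{x_1,…,x_n}, M + n)`; the
convergence is asserted for every sequence of laws with the defining finite-dimensional
distributions, and for the laws given by the stick-breaking representation. -/
theorem mainTheorem4 {X : Type*} [Countable X] [MeasurableSpace X] [MeasurableSingletonClass X]
    (α P₀ : MeasureTheory.ProbabilityMeasure X) (M : ℝ) (hM : 0 < M) :
    ∀ᵐ x ∂(MeasureTheory.Measure.infinitePi fun _ : ℕ => (P₀ : MeasureTheory.Measure X)),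
      (∀ Post : ℕ → MeasureTheory.ProbabilityMeasure (MeasureTheory.Measure X),
        (∀ n, DirichletPosterior.IsDirichletProcess
          (DirichletPosterior.posteriorMean (α : MeasureTheory.Measure X) M x n) (M + n)
          (Post n : MeasureTheory.Measure (MeasureTheory.Measure X))) →
        DirichletPosterior.TVTendstoZeroInLaw x Post) ∧
      DirichletPosterior.TVTendstoZeroInLaw x
        (DirichletPosterior.stickBreakingPosterior α M hM x) := by
  -- A single null set serves all `F`, because a countable space has countably many finite subsets;
  -- it does not depend on the choice of `Post` either.
  have hall : ∀ᵐ x ∂(MeasureTheory.Measure.infinitePi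
      fun _ : ℕ => (P₀ : MeasureTheory.Measure X)), ∀ F : Finset X,
      Tendsto (fun n => (DirichletPosterior.empirical x n).real (F : Set X)ᶜ) atTop
        (nhds ((P₀ : MeasureTheory.Measure X).real (F : Set X)ᶜ)) :=
    ae_all_iff.2 fun F => DirichletPosterior.ae_tendsto_empirical _ F.measurableSet.compl
  filter_upwards [hall] with x hx
  have hs : ∀ n : ℕ, 0 < M + n := fun n => by positivity
  have hmp := DirichletPosterior.isProbabilityMeasure_posteriorMean
    (α : MeasureTheory.Measure X) hM x
  refine ⟨fun Post hPost => ?_, ?_⟩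
  · exact DirichletPosterior.tvTendstoZeroInLaw_of_concentration _ _ hM hx Post
      (fun n => (hPost n).ae_isProbabilityMeasure)
      fun n y => (hPost n).integral_abs_sub_le (hs n) (measurableSet_singleton y)
  · exact DirichletPosterior.tvTendstoZeroInLaw_of_concentration _ _ hM hx _
      (fun n => DirichletPosterior.ae_isProbabilityMeasure_stickBreakingLaw (hs n) _)
      fun n y => DirichletPosterior.integral_abs_stickBreakingLaw_sub_le (hs n) _
        (measurableSet_singleton y)
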